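/- Let $G$ be a three-dimensional Lie group with a bi-invariant Riemannian metric $\langle\,,\rangle$ and Lie algebra $\mathfrak g$. Vector fields along a curve in $G$ are identified, by means of left-invariant fields, with $\mathfrak g$-valued functions; for such a field $W$ along a curve $\alpha$ with tangent $T=\alpha'$ let $\dot W$ be its derivative as a $\mathfrak g$-valued function, so that $D_{\alpha'}W=\dot W+\tfrac12[T,W]$. Let $I,J\subset\mathbb R$ be nondegenerate intervals, and let $\alpha:I\to G$ and $\tilde\alpha:J\to G$ be smooth curves parametrized by arc length, with nowhere vanishing curvatures $\kappa=\|D_TT\|$, $\tilde\kappa=\|D_{\tilde T}\tilde T\|$ and principal normals $N=\kappa^{-1}D_TT$, $\tilde N=\tilde\kappa^{-1}D_{\tilde T}\tilde T$. Assume that $(\alpha,\tilde\alpha)$ is a Bertrand pair: there is a continuous bijection $\varphi:I\to J$ such that, for every $s\in I$, the vectors $N(s)$ and $\tilde N(\varphi(s))$ of $\mathfrak g$ are linearly dependent. (This is the case in particular when the principal normal lines of the two curves coincide at corresponding points.) Assume also that neither curve is a general helix (a curve for which $\langle T,X\rangle$ is constant for some unit vector $X\in\mathfrak g$), and that neither curve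 is planar (a curve for which $\langle T,X\rangle=0$ for some $X\in\mathfrak g\setminus\{0\}$). A curve is called a slant helix if its principal normal makes a constant angle with some unit vector $X\in\mathfrak g$, i.e. $\langle N,X\rangle$ is constant. The tangent indicatrix of $\alpha$ is the curve $\alpha_t:I\to\mathfrak g$, $\alpha_t(s)=T(s)$. A curve $c$ in the Euclidean space $\mathfrak g$ is called a spherical helix if it lies on a sphere, is regular, and its unit tangent $\dot c/\|\dot c\|$ makes a constant angle with some unit vector $X\in\mathfrak g$. Then: (i) $\alpha$ is a slant helix if and only if $\alpha_t$ is a spherical helix; (ii) $\tilde\alpha$ is a slant helix if and only if $\alpha_t$ is a spherical helix. -/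

import Mathlib

open scoped Manifold ContDiff

noncomputable section

namespace LieCurve

variable {G : Type*} [TopologicalSpace G] [ChartedSpace (EuclideanSpace ℝ (Fin 3)) G] [Group G]

/-- Smooth Riemannian metrics on a three dimensional manifold `G`. -/
abbrev Metric (G : Type*) [TopologicalSpace G] [ChartedSpace (EuclideanSpace ℝ (Fin 3)) G]
    [IsManifold (𝓡 3) ∞ G] : Type _ :=
  Bundle.ContMDiffRiemannianMetric (𝓡 3) ∞ (EuclideanSpace ℝ (Fin 3))
    (fun x : G => TangentSpace (𝓡 3) x)

/-- A Riemannian metric is bi-invariant if all left and all right translations are isometries. -/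
structure IsBiinvariant [IsManifold (𝓡 3) ∞ G] (g : Metric G) : Prop where
  left : ∀ (a x : G) (v w : TangentSpace (𝓡 3) x),
    g.inner (a * x) (mfderiv (𝓡 3) (𝓡 3) (fun y => a * y) x v)
      (mfderiv (𝓡 3) (𝓡 3) (fun y => a * y) x w) = g.inner x v w
  right : ∀ (a x : G) (v w : TangentSpace (𝓡 3) x),
    g.inner (x * a) (mfderiv (𝓡 3) (𝓡 3) (fun y => y * a) x v)
      (mfderiv (𝓡 3) (𝓡 3) (fun y => y * a) x w) = g.inner x v w

/-- The inner product on the Lie algebra `𝔤 = T₁G` given by the metric. -/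
def ip [IsManifold (𝓡 3) ∞ G] (g : Metric G) (X Y : GroupLieAlgebra (𝓡 3) G) : ℝ :=
  g.inner (1 : G) X Y

/-- The norm on the Lie algebra `𝔤 = T₁G` given by the metric. -/
def nrm [IsManifold (𝓡 3) ∞ G] (g : Metric G) (X : GroupLieAlgebra (𝓡 3) G) : ℝ :=
  Real.sqrt (ip g X X)

/-- The velocity `α'(s)`, a tangent vector of `G` at `α(s)`, of a curve defined on `I`. -/
def velocity (I : Set ℝ) (α : ℝ → G) (s : ℝ) : TangentSpace (𝓡 3) (α s) :=
  mfderivWithin 𝓘(ℝ, ℝ) (𝓡 3) α I s (1 : ℝ)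

/-- The tangent field `T = α'`, written in terms of left-invariant fields: `T(s)` is the element of
`𝔤` whose left-invariant vector field takes the value `α'(s)` at `α(s)`, that is, the image of
`α'(s)` under left translation by `α(s)⁻¹`. For a basis `Xᵢ` of left-invariant fields and
`α' = ∑ wᵢ Xᵢ` along `α`, this is `∑ wᵢ(s) Xᵢ`. -/
def tangent (I : Set ℝ) (α : ℝ → G) (s : ℝ) : GroupLieAlgebra (𝓡 3) G :=
  (mfderiv (𝓡 3) (𝓡 3) (fun y : G => (α s)⁻¹ * y) (α s) (velocity I α s) :)

/-- The covariant derivative along `α` of a vector field `W = ∑ wᵢ Xᵢ` along `α` for the Levi-Civita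
connection of a bi-invariant metric, `D_{α'} W = Ẇ + ½ [T, W]`, where `Ẇ = ∑ wᵢ' Xᵢ`. -/
def covDeriv (I : Set ℝ) (α : ℝ → G) (W : ℝ → GroupLieAlgebra (𝓡 3) G) (s : ℝ) :
    GroupLieAlgebra (𝓡 3) G :=
  derivWithin W I s + (1 / 2 : ℝ) • ⁅tangent I α s, W s⁆

/-- The curvature `κ = ‖D_T T‖`. -/
def curvature [IsManifold (𝓡 3) ∞ G] (g : Metric G) (I : Set ℝ) (α : ℝ → G) (s : ℝ) : ℝ :=
  nrm g (covDeriv I α (tangent I α) s)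

/-- The principal normal `N = κ⁻¹ D_T T`, written in terms of left-invariant fields. -/
def principalNormal [IsManifold (𝓡 3) ∞ G] (g : Metric G) (I : Set ℝ) (α : ℝ → G) (s : ℝ) :
    GroupLieAlgebra (𝓡 3) G :=
  (curvature g I α s)⁻¹ • covDeriv I α (tangent I α) s

/-- Smooth curves parametrized by arc length on a nondegenerate interval `I`, with nowhere vanishing
curvature, so that the Frenet frame is defined. -/
structure IsFrenetCurve [IsManifold (𝓡 3) ∞ G] (g : Metric G) (I : Set ℝ) (α : ℝ → G) :
    Prop where
  ordConnected : I.OrdConnected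
  nontrivial : I.Nontrivial
  smooth : ContMDiffOn 𝓘(ℝ, ℝ) (𝓡 3) ∞ α I
  unit_speed : ∀ s ∈ I, g.inner (α s) (velocity I α s) (velocity I α s) = 1
  curvature_pos : ∀ s ∈ I, 0 < curvature g I α s

/-- `α` is a general helix: its tangent makes a constant angle with some left-invariant unit
field `X`. -/
def IsGeneralHelix [IsManifold (𝓡 3) ∞ G] (g : Metric G) (I : Set ℝ) (α : ℝ → G) : Prop :=
  ∃ (X : GroupLieAlgebra (𝓡 3) G) (θ : ℝ), nrm g X = 1 ∧
    ∀ s ∈ I, ip g (tangent I α s) X = Real.cos θ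

/-- `α` is a slant helix: its principal normal makes a constant angle with some left-invariant unit
field `X`. -/
def IsSlantHelix [IsManifold (𝓡 3) ∞ G] (g : Metric G) (I : Set ℝ) (α : ℝ → G) : Prop :=
  ∃ (X : GroupLieAlgebra (𝓡 3) G) (θ : ℝ), nrm g X = 1 ∧
    ∀ s ∈ I, ip g (principalNormal g I α s) X = Real.cos θ

/-- `α` is planar: its tangent stays in a fixed plane of left-invariant fields, the orthogonal
complement of `X`. For Frenet curves this says that the binormal is a constant element of `𝔤`,
i.e. that `τ - τ_G` vanishes identically. -/
def IsPlanar [IsManifold (𝓡 3) ∞ G] (g : Metric G) (I : Set ℝ) (α : ℝ → G) : Prop :=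
  ∃ X : GroupLieAlgebra (𝓡 3) G, X ≠ 0 ∧ ∀ s ∈ I, ip g (tangent I α s) X = 0

/-- `(α, β)` is a Bertrand pair: `α` and `β` are Frenet curves, and there is a continuous bijection
between their parameter intervals such that at corresponding points the principal normals are
linearly dependent (as combinations of left-invariant fields). When the principal normal lines, i.e.
the geodesics through the curve points in the direction of the principal normals, coincide at
corresponding points, this condition holds, since such geodesics are left translates of
one-parameter subgroups. -/
structure IsBertrandPair [IsManifold (𝓡 3) ∞ G] (g : Metric G) (I : Set ℝ) (α : ℝ → G)
    (J : Set ℝ) (β : ℝ → G) : Prop where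
  frenet_left : IsFrenetCurve g I α
  frenet_right : IsFrenetCurve g J β
  normals : ∃ φ : ℝ → ℝ, Set.BijOn φ I J ∧ ContinuousOn φ I ∧
    ∀ s ∈ I, ¬ LinearIndependent ℝ ![principalNormal g I α s, principalNormal g J β (φ s)]

/-- The tangent indicatrix `α_t` of `α`: the curve in `𝔤` described by the unit tangent `T`, here
as a function of the parameter of `α`. -/
def tangentIndicatrix (I : Set ℝ) (α : ℝ → G) : ℝ → GroupLieAlgebra (𝓡 3) G :=
  tangent I α

/-- A curve `c` in the Euclidean space `𝔤`, with an arbitrary parameter in `I`, is a spherical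
helix: it lies on a sphere, it is regular, and its unit tangent `c' / ‖c'‖` makes a constant angle
with some fixed unit vector `X`. -/
def IsSphericalHelix [IsManifold (𝓡 3) ∞ G] (g : Metric G) (I : Set ℝ)
    (c : ℝ → GroupLieAlgebra (𝓡 3) G) : Prop :=
  (∃ (p : GroupLieAlgebra (𝓡 3) G) (r : ℝ), 0 < r ∧ ∀ s ∈ I, nrm g (c s - p) = r) ∧
  (∀ s ∈ I, derivWithin c I s ≠ 0) ∧
  ∃ (X : GroupLieAlgebra (𝓡 3) G) (θ : ℝ), nrm g X = 1 ∧
    ∀ s ∈ I, ip g ((nrm g (derivWithin c I s))⁻¹ • derivWithin c I s) X = Real.cos θ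

end LieCurve

end

/-! Since [T, T] = 0, the covariant derivative D_T T is just the derivative of T as a curve in 𝔤
(`covDeriv_tangent`). Hence N is the unit tangent of the tangent indicatrix, and the slant helix
condition on α is literally the constant-angle condition on α_t. The other two requirements are
automatic: α_t lies on the unit sphere because left translations are isometries, and it is regular
because κ > 0.

For the Bertrand mate, unit normals that are linearly dependent differ by a sign. The normals and φ
are continuous and I is connected, so the sign is a constant ε (`IsBertrandPair.exists_sign`), and
replacing the axis X by εX carries one slant helix condition to the other. The technical cost is the
continuity of N, which needs T to be C¹. -/

namespace LieCurve

/-- In the coordinates of the tangent bundles, the derivative of a curve in `G` is itself at those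
parameters where the base point is that of the reference parameter. -/
theorem inTangentCoordinates_id_apply {G : Type*} [TopologicalSpace G]
    [ChartedSpace (EuclideanSpace ℝ (Fin 3)) G] [IsManifold (𝓡 3) 1 G] {k : ℝ → G}
    (ϕ : ℝ → ℝ →L[ℝ] EuclideanSpace ℝ (Fin 3)) {s r : ℝ} (hk : k r = k s) (v : ℝ) :
    inTangentCoordinates 𝓘(ℝ, ℝ) (𝓡 3) id k ϕ s r v = ϕ r v := by
  rw [inTangentCoordinates_eq _ _ _ (by simp [chartAt_self_eq]) (by simp [hk]), hk]
  simp only [ContinuousLinearMap.comp_apply, tangentBundleCore_coordChange_model_space,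
    ContinuousLinearMap.id_apply]
  exact (tangentBundleCore (𝓡 3) G).coordChange_self _ _ (by simp) _

section
variable {G : Type*} [TopologicalSpace G] [ChartedSpace (EuclideanSpace ℝ (Fin 3)) G] [Group G]

theorem IsFrenetCurve.uniqueDiffOn [IsManifold (𝓡 3) ∞ G] {g : Metric G} {I : Set ℝ} {α : ℝ → G}
    (h : IsFrenetCurve g I α) : UniqueDiffOn ℝ I := by
  refine uniqueDiffOn_convex h.ordConnected.convex ?_
  obtain ⟨a, ha, b, hb, hab⟩ := h.nontrivial.exists_lt
  refine ⟨(a + b) / 2, interior_mono (Set.Ioo_subset_Icc_self.trans (h.ordConnected.out ha hb)) ?_⟩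
  rw [interior_Ioo]
  constructor <;> linarith

/-- The correction term ½[T, T] vanishes. -/
theorem covDeriv_tangent (I : Set ℝ) (α : ℝ → G) :
    covDeriv I α (tangent I α) = derivWithin (tangent I α) I := by
  funext s
  simp [covDeriv, GroupLieAlgebra.bracket_def]

variable [LieGroup (𝓡 3) ∞ G]

/-- The tangent field is the velocity at `s` of the translated curve `t ↦ α(s)⁻¹ α(t)`. -/
theorem tangent_eq_mfderivWithin {I : Set ℝ} {α : ℝ → G} (hI : UniqueDiffOn ℝ I)
    (hα : ContMDiffOn 𝓘(ℝ, ℝ) (𝓡 3) ∞ α I) {s : ℝ} (hs : s ∈ I) :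
    (tangent I α s : EuclideanSpace ℝ (Fin 3)) =
      mfderivWithin 𝓘(ℝ, ℝ) (𝓡 3) (fun t => (α s)⁻¹ * α t) I s (1 : ℝ) := by
  have h := mfderiv_comp_mfderivWithin (I := 𝓘(ℝ, ℝ)) (I' := 𝓡 3) (I'' := 𝓡 3) s
    (g := fun y : G => (α s)⁻¹ * y) (f := α) (s := I)
    ((contMDiff_mul_left (n := ∞)).contMDiffAt.mdifferentiableAt (by simp))
    ((hα s hs).mdifferentiableWithinAt (by simp)) (hI s hs).uniqueMDiffWithinAt
  have h' := congrArg (fun L : ℝ →L[ℝ] EuclideanSpace ℝ (Fin 3) => L 1) h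
  exact h'.symm

/-- T(r) is the derivative in t, at t = r, of the smooth two-parameter map α(r)⁻¹ α(t), so it
depends smoothly on r. Order 1 suffices to make N continuous. -/
theorem contDiffOn_tangent {I : Set ℝ} {α : ℝ → G} (hI : UniqueDiffOn ℝ I)
    (hα : ContMDiffOn 𝓘(ℝ, ℝ) (𝓡 3) ∞ α I) :
    ContDiffOn (F := EuclideanSpace ℝ (Fin 3)) ℝ 1 (tangent I α) I := by
  have : IsManifold (𝓡 3) 1 G := IsManifold.of_le (n := ∞) (by simp)
  intro s hs
  have hinv : ContMDiffOn 𝓘(ℝ, ℝ) (𝓡 3) ∞ (fun t => (α t)⁻¹) I := hα.inv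
  have hF : ContMDiffWithinAt (𝓘(ℝ, ℝ).prod 𝓘(ℝ, ℝ)) (𝓡 3) ∞
      (Function.uncurry (fun r t => (α r)⁻¹ * α t)) (I ×ˢ I) (s, s) :=
    ((hinv s hs).comp (s, s) contMDiffWithinAt_fst (fun p hp => hp.1)).mul
      ((hα s hs).comp (s, s) contMDiffWithinAt_snd (fun p hp => hp.2))
  have h := ContMDiffWithinAt.mfderivWithin (m := 1) hF contMDiffWithinAt_id hs
    (Set.mapsTo_id I) (by norm_num; exact WithTop.coe_le_coe.mpr le_top) hI.uniqueMDiffOn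
  have h1 := h.contDiffWithinAt.clm_apply (contDiffWithinAt_const (c := (1 : ℝ)))
  refine h1.congr_of_mem (fun r hr => ?_) hs
  -- The base point α(r)⁻¹ α(r) is 1 for every r, so the change of coordinates is trivial.
  have key := inTangentCoordinates_id_apply (k := fun r => (α r)⁻¹ * α r)
    (fun r => mfderivWithin 𝓘(ℝ, ℝ) (𝓡 3) (fun t => (α r)⁻¹ * α t) I r)
    (r := r) (s := s) (by simp) 1
  exact (tangent_eq_mfderivWithin hI hα hr).trans key.symm

variable {g : Metric G}

theorem ip_tangent_tangent (hg : IsBiinvariant g) {I : Set ℝ} {α : ℝ → G}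
    (h : IsFrenetCurve g I α) {s : ℝ} (hs : s ∈ I) :
    ip g (tangent I α s) (tangent I α s) = 1 := by
  have h1 := hg.left (α s)⁻¹ (α s) (velocity I α s) (velocity I α s)
  rw [h.unit_speed s hs] at h1
  -- The translated vector sits over α(s)⁻¹ α(s), equal to 1 only propositionally; generalizing the
  -- base point allows the transport between fibres.
  have key : ∀ x : G, x = 1 → ∀ v : EuclideanSpace ℝ (Fin 3),
    g.inner x v v = g.inner (1 : G) v v := by rintro _ rfl v; rfl
  exact (key _ (inv_mul_cancel (α s)) _).symm.trans h1

theorem continuous_ip (g : Metric G) :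
    Continuous fun p : EuclideanSpace ℝ (Fin 3) × EuclideanSpace ℝ (Fin 3) => ip g p.1 p.2 := by
  let B : EuclideanSpace ℝ (Fin 3) →L[ℝ] EuclideanSpace ℝ (Fin 3) →L[ℝ] ℝ := g.inner (1 : G)
  exact (B.continuous.comp continuous_fst).clm_apply continuous_snd

theorem ip_smul_left (g : Metric G) (c : ℝ) (X Y : GroupLieAlgebra (𝓡 3) G) :
    ip g (c • X) Y = c * ip g X Y := by
  simp [ip]

theorem ip_smul_right (g : Metric G) (c : ℝ) (X Y : GroupLieAlgebra (𝓡 3) G) :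
    ip g X (c • Y) = c * ip g X Y := by
  simp [ip]

theorem ip_self_nonneg (g : Metric G) (X : GroupLieAlgebra (𝓡 3) G) : 0 ≤ ip g X X := by
  rcases eq_or_ne X 0 with rfl | h
  · simp [ip]
  · exact (g.pos 1 X h).le

theorem continuousOn_derivWithin_tangent {I : Set ℝ} {α : ℝ → G} (h : IsFrenetCurve g I α) :
    ContinuousOn (Y := EuclideanSpace ℝ (Fin 3)) (derivWithin (tangent I α) I) I :=
  (contDiffOn_tangent h.uniqueDiffOn h.smooth).continuousOn_derivWithin h.uniqueDiffOn le_rfl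

theorem continuousOn_principalNormal {I : Set ℝ} {α : ℝ → G} (h : IsFrenetCurve g I α) :
    ContinuousOn (Y := EuclideanSpace ℝ (Fin 3)) (principalNormal g I α) I := by
  have hd := continuousOn_derivWithin_tangent h
  have hκ : ContinuousOn (curvature g I α) I := by
    have : curvature g I α = fun s => Real.sqrt (ip g (derivWithin (tangent I α) I s)
        (derivWithin (tangent I α) I s)) := by
      funext s
      rw [curvature, covDeriv_tangent, nrm]
    rw [this]
    exact Real.continuous_sqrt.comp_continuousOn
      ((continuous_ip g).comp_continuousOn (hd.prodMk hd))
  have hN := ContinuousOn.smul (X := EuclideanSpace ℝ (Fin 3))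
    (hκ.inv₀ fun s hs => (h.curvature_pos s hs).ne') hd
  refine hN.congr fun s _ => ?_
  rw [principalNormal, covDeriv_tangent]
  rfl

theorem ip_principalNormal_self {I : Set ℝ} {α : ℝ → G} (h : IsFrenetCurve g I α) {s : ℝ}
    (hs : s ∈ I) : ip g (principalNormal g I α s) (principalNormal g I α s) = 1 := by
  have hκ := h.curvature_pos s hs
  have hsq : curvature g I α s ^ 2 = ip g (covDeriv I α (tangent I α) s)
      (covDeriv I α (tangent I α) s) := Real.sq_sqrt (ip_self_nonneg _ _)
  rw [principalNormal, ip_smul_left, ip_smul_right, ← hsq]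
  field_simp

theorem isSlantHelix_iff_isSphericalHelix (hg : IsBiinvariant g) {I : Set ℝ} {α : ℝ → G}
    (h : IsFrenetCurve g I α) :
    IsSlantHelix g I α ↔ IsSphericalHelix g I (tangentIndicatrix I α) := by
  have hN : ∀ s, (nrm g (derivWithin (tangent I α) I s))⁻¹ • derivWithin (tangent I α) I s =
      principalNormal g I α s := fun s => by
    rw [principalNormal, curvature, covDeriv_tangent]
  unfold IsSlantHelix IsSphericalHelix tangentIndicatrix
  simp only [hN]
  refine ⟨fun hX => ⟨⟨0, 1, one_pos, fun s hs => ?_⟩, fun s hs h0 => ?_, hX⟩, fun hX => hX.2.2⟩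
  · rw [sub_zero, nrm, ip_tangent_tangent hg h hs, Real.sqrt_one]
  -- A zero of the derivative of T would be a zero of κ.
  · have := h.curvature_pos s hs
    rw [curvature, covDeriv_tangent, h0] at this
    simp [nrm, ip] at this

/-- Linearly dependent unit vectors agree up to the sign given by their inner product. -/
theorem eq_ip_smul_of_not_linearIndependent {X Y : GroupLieAlgebra (𝓡 3) G} (hX : ip g X X = 1)
    (hY : ip g Y Y = 1) (h : ¬ LinearIndependent ℝ ![X, Y]) :
    Y = ip g X Y • X ∧ (ip g X Y = 1 ∨ ip g X Y = -1) := by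
  have hX0 : X ≠ 0 := by
    rintro rfl
    simp [ip] at hX
  rw [LinearIndependent.pair_iff' hX0] at h
  push Not at h
  obtain ⟨c, rfl⟩ := h
  rw [ip_smul_left, ip_smul_right, hX] at hY
  rw [ip_smul_right, hX, mul_one]
  exact ⟨rfl, mul_self_eq_one_iff.mp (by linarith)⟩

/-- The normals of a Bertrand pair agree at corresponding points, up to a sign which does not
depend on the point. -/
theorem IsBertrandPair.exists_sign {I J : Set ℝ} {α β : ℝ → G} (h : IsBertrandPair g I α J β) :
    ∃ (φ : ℝ → ℝ) (ε : ℝ), Set.BijOn φ I J ∧ (ε = 1 ∨ ε = -1) ∧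
      ∀ s ∈ I, principalNormal g J β (φ s) = ε • principalNormal g I α s := by
  obtain ⟨φ, hφ, hφc, hdep⟩ := h.normals
  have hNα := continuousOn_principalNormal h.frenet_left
  have hNβ := (continuousOn_principalNormal h.frenet_right).comp hφc hφ.mapsTo
  have hcont : ContinuousOn
      (fun s => ip g (principalNormal g I α s) (principalNormal g J β (φ s))) I :=
    (continuous_ip g).comp_continuousOn (hNα.prodMk hNβ)
  have hsign := fun s (hs : s ∈ I) => eq_ip_smul_of_not_linearIndependent
    (ip_principalNormal_self h.frenet_left hs)
    (ip_principalNormal_self h.frenet_right (hφ.mapsTo hs)) (hdep s hs)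
  obtain ⟨a, ha⟩ := h.frenet_left.nontrivial.nonempty
  -- The sign ε is the inner product of the two normals at the reference parameter a.
  refine ⟨φ, _, hφ, (hsign a ha).2, fun s hs => ?_⟩
  rw [(hsign s hs).1]
  congr 1
  -- A continuous function from an interval to the discrete set {1, -1} is constant.
  exact h.frenet_left.ordConnected.isPreconnected.constant_of_mapsTo
    (T := ({1, -1} : Set ℝ)) (Set.toFinite _).isDiscrete hcont (fun t ht => (hsign t ht).2) hs ha

theorem IsBertrandPair.isSlantHelix_iff {I J : Set ℝ} {α β : ℝ → G}
    (h : IsBertrandPair g I α J β) : IsSlantHelix g J β ↔ IsSlantHelix g I α := by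
  obtain ⟨φ, ε, hφ, hε, hN⟩ := h.exists_sign
  have hεε : ε * ε = 1 := mul_self_eq_one_iff.mpr hε
  have key : ∀ X : GroupLieAlgebra (𝓡 3) G, nrm g X = 1 → nrm g (ε • X) = 1 := fun X hX => by
    rwa [nrm, ip_smul_left, ip_smul_right, ← mul_assoc, hεε, one_mul]
  constructor
  · rintro ⟨X, θ, hX, hc⟩
    refine ⟨ε • X, θ, key X hX, fun s hs => ?_⟩
    rw [← hc _ (hφ.mapsTo hs), hN s hs, ip_smul_left, ip_smul_right]
  · rintro ⟨X, θ, hX, hc⟩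
    refine ⟨ε • X, θ, key X hX, fun t ht => ?_⟩
    -- Surjectivity of φ is what brings the condition to every parameter of the second curve.
    obtain ⟨s, hs, rfl⟩ := hφ.surjOn ht
    rw [← hc s hs, hN s hs, ip_smul_left, ip_smul_right, ← mul_assoc, hεε, one_mul]

end
end LieCurve

theorem theorem3p5 {G : Type*} [TopologicalSpace G]
    [ChartedSpace (EuclideanSpace ℝ (Fin 3)) G] [Group G] [LieGroup (𝓡 3) ∞ G]
    (g : LieCurve.Metric G) (hg : LieCurve.IsBiinvariant g)
    (I J : Set ℝ) (α β : ℝ → G) (hpair : LieCurve.IsBertrandPair g I α J β)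
    (hα_helix : ¬ LieCurve.IsGeneralHelix g I α) (hβ_helix : ¬ LieCurve.IsGeneralHelix g J β)
    (hα_planar : ¬ LieCurve.IsPlanar g I α) (hβ_planar : ¬ LieCurve.IsPlanar g J β) :
    (LieCurve.IsSlantHelix g I α ↔
      LieCurve.IsSphericalHelix g I (LieCurve.tangentIndicatrix I α)) ∧
    (LieCurve.IsSlantHelix g J β ↔
      LieCurve.IsSphericalHelix g I (LieCurve.tangentIndicatrix I α)) :=
  ⟨LieCurve.isSlantHelix_iff_isSphericalHelix hg hpair.frenet_left,
    hpair.isSlantHelix_iff.trans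
      (LieCurve.isSlantHelix_iff_isSphericalHelix hg hpair.frenet_left)⟩
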